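/- Model: a word RAM whose words have $W=\kappa(\lfloor\log_2 n\rfloor+1)$ bits, where $n$ is the length of the input string and $\kappa$ is any sufficiently large constant. A problem is solved in $O(f(n))$ space with $O(1)$ query time if there are a constant $\kappa_0$ and, for every constant $\kappa\ge\kappa_0$, a single query program and constants $T,A$ (independent of the instance) such that for every instance, with string of length $n$, there is a memory content of at most $A\,f(n)$ words with which the program answers every query correctly within $T$ steps. The generalised suffix tree of strings $w_1,\dots,w_\beta$ is the compacted trie of all suffixes of $w_1\$_1,\dots,w_\beta\$_\beta$, where the $\$_i$ are distinct letters that occur in none of the $w_i$; the suffix tree of $w$ is the case $\beta=1$. To retrieve the node of a string in such a tree means to return a pointer to this node if it is explicit, and a pointer to the edge on which it lies if it is implicit (and to tell which is the case); pointers are given by an arbitrary numbering $0,1,\dots,N-1$ of the explicit nodes of the tree, and a pointer to an edge is the pointer to its lower endpoint. General substring retrieval: given a string $w$ of length $n$, preprocess its suffix tree so that for any positions $i\le j$ of $w$ the node of $w[i..j]$ in this tree can be retrieved. Long substring retrieval: given a string $w$ of length $n$, an integer $\ell\ge 1$ and documents $w_1,\dots,w_\beta$ which are substrings of $w$, all of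 length $\ell$, with $\beta=O(n/\ell)$ (that is, $\beta\ell\le cn$ for a constant $c$), preprocess their generalised suffix tree so that for any $k$ and $i\le j$ with $j-i+1\ge\frac34\ell$ the node of $w_k[i..j]$ in this tree can be retrieved. It is solved in $O(f(n))$ space with $O(1)$ query time if this holds for every constant $c$, where $\kappa_0$, the program and the constants $T,A$ may depend on $c$. **Lemma.** Let $S:\mathbb N\to\mathbb N$ be any function. If long substring retrieval for strings over an alphabet $\sigma$ can be solved in $O(S(n))$ space with $O(1)$ query time, then general substring retrieval for strings over $\sigma$ can be solved in $O\big((S(n)+n)(\lfloor\log_2 n\rfloor+1)\big)$ space with $O(1)$ query time; for $n\ge 2$ this bound is $O((S(n)+n)\log n)$. -/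

import Mathlib

namespace SubstringRetrieval

/-! ### The word RAM

Words of `W` bits are the natural numbers below `2 ^ W`; all arithmetic is reduced modulo `2 ^ W`. -/

/-- The binary word operations, each of unit cost. -/
inductive WordOp
  | add | sub | mul | div | mod | and | or | xor | shl | shr

/-- Value of an operation on two words of `W` bits. -/
def WordOp.eval (W : ℕ) : WordOp → ℕ → ℕ → ℕ
  | .add, a, b => (a + b) % 2 ^ W
  | .sub, a, b => (a + (2 ^ W - b)) % 2 ^ W
  | .mul, a, b => (a * b) % 2 ^ W
  | .div, a, b => a / b
  | .mod, a, b => a % b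
  | .and, a, b => a &&& b
  | .or, a, b => a ||| b
  | .xor, a, b => a ^^^ b
  | .shl, a, b => (a * 2 ^ b) % 2 ^ W
  | .shr, a, b => a / 2 ^ b

/-- Instructions of a query program. `const d c` puts the constant `c` into register `d`;
`binop o d a b` applies `o` to registers `a`, `b` and puts the result into register `d`;
`load d a` reads the memory cell whose address is in register `a` into register `d`;
`jumpLt a b t` jumps to instruction `t` if the content of register `a` is less than that
of register `b`. -/
inductive Instr
  | const (d c : ℕ)
  | binop (o : WordOp) (d a b : ℕ)
  | load (d a : ℕ)
  | jumpLt (a b t : ℕ)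

/-- Program counter and register contents. (A program, being finite, uses only constantly many
registers.) -/
structure Config where
  pc : ℕ
  reg : ℕ → ℕ

/-- Effect of one instruction; `D` is the (read-only) preprocessed memory, and cells outside of it
contain `0`. -/
def Instr.exec (W : ℕ) (D : List ℕ) (s : Config) : Instr → Config
  | .const d c => ⟨s.pc + 1, Function.update s.reg d (c % 2 ^ W)⟩
  | .binop o d a b => ⟨s.pc + 1, Function.update s.reg d (o.eval W (s.reg a) (s.reg b))⟩
  | .load d a => ⟨s.pc + 1, Function.update s.reg d (D.getD (s.reg a) 0)⟩
  | .jumpLt a b t => ⟨if s.reg a < s.reg b then t else s.pc + 1, s.reg⟩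

/-- One step of a program; the machine has halted, and no longer changes, once the program counter
has left the program. -/
def step (W : ℕ) (P : List Instr) (D : List ℕ) (s : Config) : Config :=
  match P[s.pc]? with
  | some ins => ins.exec W D s
  | none => s

/-- At the start the input words are in registers `0, 1, 2, …`, all other registers are `0`. -/
def initConfig (input : List ℕ) : Config := ⟨0, fun r => input.getD r 0⟩

/-- Run on memory `D` and the given input, program `P` halts within `T` steps, and the contents of
registers `0` and `1` are then related by `good`. -/
def Answers (W : ℕ) (P : List Instr) (T : ℕ) (D : List ℕ) (input : List ℕ)
    (good : ℕ → ℕ → Prop) : Prop :=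
  let s := (step W P D)^[T] (initConfig input)
  P.length ≤ s.pc ∧ good (s.reg 0) (s.reg 1)

/-- Logarithmic word size, with constant factor `κ`. -/
def wordSize (κ n : ℕ) : ℕ := κ * (Nat.log 2 n + 1)

/-! ### Generalised suffix trees

A node of the trie, explicit or implicit, is identified with the string that it represents.
The separator `$ᵢ` is the letter `Sum.inr i`. -/

section Tree

variable {σ : Type*} {β : ℕ}

/-- The `i`-th document followed by its separator. -/
def terminated (docs : Fin β → List σ) (i : Fin β) : List (σ ⊕ Fin β) :=
  (docs i).map Sum.inl ++ [Sum.inr i]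

/-- The (explicit or implicit) nodes of the generalised suffix tree: all prefixes of suffixes of the
terminated documents. -/
def IsNode (docs : Fin β → List σ) (x : List (σ ⊕ Fin β)) : Prop :=
  ∃ i, ∃ y, y <:+ terminated docs i ∧ x <+: y

/-- The explicit nodes: the root, the leaves and the branching nodes. -/
def IsExplicit (docs : Fin β → List σ) (x : List (σ ⊕ Fin β)) : Prop :=
  IsNode docs x ∧
    (x = [] ∨ (¬ ∃ a, IsNode docs (x ++ [a])) ∨
      ∃ a b, a ≠ b ∧ IsNode docs (x ++ [a]) ∧ IsNode docs (x ++ [b]))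

/-- `(u, v)` is an edge of the compacted trie, `v` being its lower endpoint. -/
def IsEdge (docs : Fin β → List σ) (u v : List (σ ⊕ Fin β)) : Prop :=
  IsExplicit docs u ∧ IsExplicit docs v ∧ u <+: v ∧ u ≠ v ∧
    ∀ x, IsExplicit docs x → u <+: x → x <+: v → x = u ∨ x = v

/-- Pointers: `ptr` numbers the explicit nodes by `0, 1, …, N - 1`, where `N` is their number, in
some arbitrary order. -/
def IsPointerMap (docs : Fin β → List σ) (ptr : List (σ ⊕ Fin β) → ℕ) : Prop :=
  ∃ N, Set.BijOn ptr {x | IsExplicit docs x} (Set.Iio N)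

/-- `(kind, p)` points to the node of the string `s`: if this node is explicit, then `kind = 0` and
`p` is the pointer to it; if it is implicit, then `kind = 1` and `p` is the pointer to the edge on
which it lies, an edge being pointed to through its lower endpoint. -/
def PointsTo (docs : Fin β → List σ) (ptr : List (σ ⊕ Fin β) → ℕ) (s : List σ)
    (kind p : ℕ) : Prop :=
  let x : List (σ ⊕ Fin β) := s.map Sum.inl
  (IsExplicit docs x ∧ kind = 0 ∧ p = ptr x) ∨
    (¬ IsExplicit docs x ∧ kind = 1 ∧
      ∃ u v, IsEdge docs u v ∧ u <+: x ∧ x <+: v ∧ p = ptr v)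

end Tree

/-- The substring of `w` from position `i` to position `j`, both inclusive, counted from `0`. -/
def substr {σ : Type*} (w : List σ) (i j : ℕ) : List σ := (w.drop i).take (j + 1 - i)

/-! ### The two problems -/

/-- Long substring retrieval for strings over `σ` can be solved in `O(f n)` space with `O(1)` query
time on a word RAM with logarithmic word size.

An instance consists of a string `w` of length `n`, a length `ℓ`, and `β ≤ c n / ℓ` documents of
length `ℓ`, the `k`-th being the substring of `w` that starts at `start k`. A query `(k, i, j)` asks
for the node of the substring `i..j` of the `k`-th document, of length at least `3 ℓ / 4`, in the
generalised suffix tree of the documents. The constants and the query program may depend on the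
constant `c` and on the word size constant `κ`, which may be any sufficiently large one, but not on
the instance. -/
def LongSolvable (σ : Type*) (f : ℕ → ℕ) : Prop :=
  ∀ c : ℕ, ∃ κ₀ : ℕ, ∀ κ ≥ κ₀, ∃ (P : List Instr) (T A : ℕ),
    ∀ (w : List σ) (ℓ β : ℕ) (start : Fin β → ℕ) (ptr : List (σ ⊕ Fin β) → ℕ),
      0 < ℓ → β * ℓ ≤ c * w.length → (∀ k, start k + ℓ ≤ w.length) →
      let docs : Fin β → List σ := fun k => (w.drop (start k)).take ℓ
      IsPointerMap docs ptr →
      ∃ D : List ℕ, D.length ≤ A * f w.length ∧ (∀ x ∈ D, x < 2 ^ wordSize κ w.length) ∧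
        ∀ (k : Fin β) (i j : ℕ), i ≤ j → j < ℓ → 3 * ℓ ≤ 4 * (j + 1 - i) →
          Answers (wordSize κ w.length) P T D [k, i, j]
            (PointsTo docs ptr (substr (docs k) i j))

/-- General substring retrieval for strings over `σ` can be solved in `O(f n)` space with `O(1)`
query time on a word RAM with logarithmic word size.

An instance is a string `w` of length `n`; a query `(i, j)` asks for the node of the substring
`i..j` of `w` in the suffix tree of `w`, that is, the generalised suffix tree of the one
document `w`. -/
def GeneralSolvable (σ : Type*) (f : ℕ → ℕ) : Prop :=
  ∃ κ₀ : ℕ, ∀ κ ≥ κ₀, ∃ (P : List Instr) (T A : ℕ),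
    ∀ (w : List σ) (ptr : List (σ ⊕ Fin 1) → ℕ),
      let docs : Fin 1 → List σ := fun _ => w
      IsPointerMap docs ptr →
      ∃ D : List ℕ, D.length ≤ A * f w.length ∧ (∀ x ∈ D, x < 2 ^ wordSize κ w.length) ∧
        ∀ i j : ℕ, i ≤ j → j < w.length →
          Answers (wordSize κ w.length) P T D [i, j]
            (PointsTo docs ptr (substr w i j))

end SubstringRetrieval

/-!
Group the lengths of substrings into `O(log n)` scales. For one scale, take overlapping windows of
`w` so long and so dense that each substring of this scale, together with one more letter, lies in a
window, and constitutes at least three quarters of it; the windows have total length `O(n)`. A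
string of the scale that branches in the suffix tree of `w` then branches in the windows' tree too,
so strings on one edge of the windows' tree lie on one edge of the suffix tree of `w`, and a table
with `O(n)` entries per scale turns a pointer into the windows' tree into the required one.

The given program knows nothing of several memories. It is simulated with words of `W' < W` bits,
which leaves room in an address for the number of the scale, on a memory in which the cells of all
scales are interleaved.
-/

namespace SubstringRetrieval

/-! ### Nodes and pointers -/

theorem exists_longest {α : Type*} {S : Set (List α)} {B : ℕ} (hne : S.Nonempty)
    (hB : ∀ s ∈ S, s.length ≤ B) : ∃ s ∈ S, ∀ s' ∈ S, s'.length ≤ s.length := by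
  have hbdd : BddAbove (List.length '' S) := ⟨B, Set.forall_mem_image.2 hB⟩
  obtain ⟨s, hs, hlen⟩ := Nat.sSup_mem (hne.image _) hbdd
  exact ⟨s, hs, fun s' hs' => hlen ▸ le_csSup hbdd (Set.mem_image_of_mem _ hs')⟩

theorem filterMap_getLeft?_map_inl {α γ : Type*} (s : List α) :
    (s.map (Sum.inl : α → α ⊕ γ)).filterMap Sum.getLeft? = s :=
  List.filterMap_map.trans List.filterMap_some

section Nodes

variable {σ : Type*} {β : ℕ} {docs : Fin β → List σ} {ptr : List (σ ⊕ Fin β) → ℕ}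

theorem isNode_iff_infix {x : List (σ ⊕ Fin β)} : IsNode docs x ↔ ∃ i, x <:+: terminated docs i :=
  ⟨fun ⟨i, _, hy, hx⟩ => ⟨i, hx.isInfix.trans hy.isInfix⟩,
    fun ⟨i, p, q, h⟩ => ⟨i, x ++ q, ⟨p, by simpa using h⟩, List.prefix_append _ _⟩⟩

theorem IsNode.of_prefix {x y : List (σ ⊕ Fin β)} (h : IsNode docs y) (hxy : x <+: y) :
    IsNode docs x := by
  obtain ⟨i, hy⟩ := isNode_iff_infix.1 h
  exact isNode_iff_infix.2 ⟨i, hxy.isInfix.trans hy⟩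

theorem IsNode.length_le {x : List (σ ⊕ Fin β)} (h : IsNode docs x) :
    x.length ≤ ∑ i, (terminated docs i).length := by
  obtain ⟨i, hi⟩ := isNode_iff_infix.1 h
  exact hi.length_le.trans (Finset.single_le_sum_of_canonicallyOrdered
    (f := fun i => (terminated docs i).length) (Finset.mem_univ i))

theorem isNode_map_inl_iff {s : List σ} : IsNode docs (s.map Sum.inl) ↔ ∃ i, s <:+: docs i := by
  rw [isNode_iff_infix]
  refine exists_congr fun i => ⟨fun h => ?_, fun h => ?_⟩
  · have hleft := h.filterMap Sum.getLeft?
    rwa [terminated, List.filterMap_append, filterMap_getLeft?_map_inl,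
      filterMap_getLeft?_map_inl, List.filterMap_cons_none rfl, List.filterMap_nil,
      List.append_nil] at hleft
  · exact (h.map Sum.inl).trans (List.prefix_append _ _).isInfix

theorem isNode_map_inl_append_inr_iff {s : List σ} {k : Fin β} :
    IsNode docs (s.map Sum.inl ++ [Sum.inr k]) ↔ s <:+ docs k := by
  have hinl : s.map (Sum.inl : σ → σ ⊕ Fin β) <:+ (docs k).map Sum.inl ↔ s <:+ docs k :=
    List.suffix_map_iff_of_injective Sum.inl_injective
  rw [isNode_iff_infix, ← hinl]
  constructor
  · rintro ⟨i, h⟩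
    rcases List.infix_concat_iff.1 h with h | h
    · obtain ⟨hs, hk⟩ := (List.suffix_append_inj_of_length_eq (by simp)).1 h
      obtain rfl : k = i := by simpa using hk
      exact hs
    · simpa using h.subset (List.mem_append_right _ (List.mem_singleton_self (Sum.inr k)))
  · exact fun h => ⟨k, ((List.suffix_append_inj_of_length_eq rfl).2 ⟨h, rfl⟩).isInfix⟩

theorem IsNode.exists_append_of_map_inl {s : List σ} (h : IsNode docs (s.map Sum.inl)) :
    ∃ a, IsNode docs (s.map Sum.inl ++ [a]) := by
  obtain ⟨i, p, q, h⟩ := isNode_map_inl_iff.1 h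
  cases q with
  | nil => exact ⟨_, isNode_map_inl_append_inr_iff.2 ⟨p, by simpa using h⟩⟩
  | cons a q =>
    have : IsNode docs ((s ++ [a]).map Sum.inl) := isNode_map_inl_iff.2 ⟨i, p, q, by simpa using h⟩
    exact ⟨Sum.inl a, by simpa using this⟩

theorem IsNode.exists_explicit_extension {x : List (σ ⊕ Fin β)} (h : IsNode docs x) :
    ∃ v, IsExplicit docs v ∧ x <+: v := by
  obtain ⟨v, ⟨hv, hxv⟩, hmax⟩ := exists_longest (S := {v | IsNode docs v ∧ x <+: v})
    ⟨x, h, List.prefix_rfl⟩ fun _ hv => hv.1.length_le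
  refine ⟨v, ⟨hv, Or.inr (Or.inl ?_)⟩, hxv⟩
  rintro ⟨a, ha⟩
  simpa using hmax _ ⟨ha, hxv.trans (List.prefix_append _ _)⟩

theorem IsNode.exists_edge {x : List (σ ⊕ Fin β)} (h : IsNode docs x)
    (hx : ¬ IsExplicit docs x) : ∃ u v, IsEdge docs u v ∧ u <+: x ∧ x <+: v := by
  obtain ⟨v, ⟨hv, hxv⟩, hmin⟩ := exists_minimalFor_of_wellFoundedLT
    (fun v => IsExplicit docs v ∧ x <+: v) List.length h.exists_explicit_extension
  obtain ⟨u, ⟨hu, hux⟩, hmax⟩ := exists_longest (S := {u | IsExplicit docs u ∧ u <+: x})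
    ⟨[], ⟨h.of_prefix List.nil_prefix, Or.inl rfl⟩, List.nil_prefix⟩ fun _ hu => hu.2.length_le
  refine ⟨u, v, ⟨hu, hv, hux.trans hxv, ?_, fun y hy huy hyv => ?_⟩, hux, hxv⟩
  · rintro rfl
    exact hx (hux.eq_of_length_le hxv.length_le ▸ hu)
  · rcases List.prefix_or_prefix_of_prefix hyv hxv with hyx | hxy
    · exact Or.inl (huy.eq_of_length_le (hmax y ⟨hy, hyx⟩)).symm
    · exact Or.inr (hyv.eq_of_length_le (hmin ⟨hy, hxy⟩ hyv.length_le))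

theorem IsNode.exists_pointsTo (ptr : List (σ ⊕ Fin β) → ℕ) {s : List σ}
    (h : IsNode docs (s.map Sum.inl)) : ∃ kind p, PointsTo docs ptr s kind p := by
  by_cases hs : IsExplicit docs (s.map Sum.inl)
  · exact ⟨0, _, Or.inl ⟨hs, rfl, rfl⟩⟩
  · obtain ⟨u, v, he, hu, hv⟩ := h.exists_edge hs
    exact ⟨1, _, Or.inr ⟨hs, rfl, u, v, he, hu, hv, rfl⟩⟩

theorem PointsTo.kind_le_one {s : List σ} {kind p : ℕ} (h : PointsTo docs ptr s kind p) :
    kind ≤ 1 := by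
  rcases h with ⟨-, rfl, -⟩ | ⟨-, rfl, -⟩ <;> simp

/-- The nodes of `s₁` and `s₂` lie, in this order, in the interior of one edge of the tree. -/
def SameEdge (docs : Fin β → List σ) (s₁ s₂ : List σ) : Prop :=
  s₁ <+: s₂ ∧ ∀ r, s₁ <+: r → r <+: s₂ → ¬ IsExplicit docs (r.map Sum.inl)

theorem PointsTo.eq_or_sameEdge {s₁ s₂ : List σ} {kind p : ℕ}
    (hptr : Set.InjOn ptr {x | IsExplicit docs x}) (h₁ : PointsTo docs ptr s₁ kind p)
    (h₂ : PointsTo docs ptr s₂ kind p) (hle : s₁.length ≤ s₂.length) :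
    s₁ = s₂ ∨ SameEdge docs s₁ s₂ := by
  rcases h₁ with ⟨hx₁, rfl, rfl⟩ | ⟨hx₁, rfl, u, v, he, hu₁, hv₁, rfl⟩ <;>
    rcases h₂ with ⟨hx₂, hk, hp⟩ | ⟨hx₂, hk, u', v', he', -, hv₂, hp⟩
  · exact Or.inl (List.map_injective_iff.2 Sum.inl_injective (hptr hx₁ hx₂ hp))
  · cases hk
  · cases hk
  obtain rfl := hptr he.2.1 he'.2.1 hp
  have hpre := List.prefix_of_prefix_length_le hv₁ hv₂ (by simpa using hle)
  refine Or.inr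
    ⟨(List.prefix_map_iff_of_injective Sum.inl_injective).1 hpre, fun r h₁r hr₂ hr => ?_⟩
  rcases he.2.2.2.2 _ hr (hu₁.trans (h₁r.map _)) ((hr₂.map _).trans hv₂) with hru | hrv
  · exact hx₁ ((h₁r.map _).eq_of_length_le (hru ▸ hu₁.length_le) ▸ hr)
  · exact hx₂ ((hr₂.map _).eq_of_length_le (hrv ▸ hv₂.length_le) ▸ hr)

theorem SameEdge.pointsTo {s₁ s₂ : List σ} {kind p : ℕ} (h : SameEdge docs s₁ s₂)
    (h₂ : PointsTo docs ptr s₂ kind p) : PointsTo docs ptr s₁ kind p := by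
  obtain ⟨hpre, hnot⟩ := h
  rcases h₂ with ⟨hx, -⟩ | ⟨-, rfl, u, v, he, hu, hv, rfl⟩
  · exact absurd hx (hnot _ hpre List.prefix_rfl)
  refine Or.inr ⟨hnot _ List.prefix_rfl hpre, rfl, u, v, he, ?_, (hpre.map _).trans hv, rfl⟩
  refine (List.prefix_or_prefix_of_prefix hu (hpre.map _)).resolve_right fun h₁u => ?_
  obtain ⟨r, hr, rfl⟩ := List.prefix_map_iff.1 hu
  exact hnot r ((List.prefix_map_iff_of_injective Sum.inl_injective).1 h₁u) hr he.1

/-- Every substring of `w` of length at most `m + 1` occurs in some document, and every suffix of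
`w` of length at most `m` ends some document: then branching of the suffix tree of `w` at depth at
most `m` is visible in the generalised suffix tree of the documents. -/
def Covers (docs : Fin β → List σ) (w : List σ) (m : ℕ) : Prop :=
  (∀ r, r <:+: w → r.length ≤ m + 1 → ∃ k, r <:+: docs k) ∧
    ∀ r, r <:+ w → r.length ≤ m → ∃ k, r <:+ docs k

theorem Covers.mono {w : List σ} {m m' : ℕ} (h : Covers docs w m) (hm : m' ≤ m) :
    Covers docs w m' :=
  ⟨fun r hr hl => h.1 r hr (hl.trans (Nat.succ_le_succ hm)), fun r hr hl => h.2 r hr (hl.trans hm)⟩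

theorem IsExplicit.of_covers {w s : List σ} (hcov : Covers docs w s.length)
    (h : IsExplicit (fun _ : Fin 1 => w) (s.map Sum.inl)) : IsExplicit docs (s.map Sum.inl) := by
  obtain ⟨hinfix, hsuffix⟩ := hcov
  have hnode : ∀ r : List σ, r.length ≤ s.length + 1 →
      IsNode (fun _ : Fin 1 => w) (r.map Sum.inl) → IsNode docs (r.map Sum.inl) := fun r hl hr =>
    isNode_map_inl_iff.2 (hinfix r (isNode_map_inl_iff.1 hr).choose_spec hl)
  have hinl : ∀ a, IsNode (fun _ : Fin 1 => w) (s.map Sum.inl ++ [Sum.inl a]) →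
      IsNode docs (s.map Sum.inl ++ [Sum.inl a]) := fun a ha => by
    simpa using hnode (s ++ [a]) (by simp) (by simpa using ha)
  have hinr : ∀ e, IsNode (fun _ : Fin 1 => w) (s.map Sum.inl ++ [Sum.inr e]) →
      ∃ k, IsNode docs (s.map Sum.inl ++ [Sum.inr k]) := fun e he =>
    (hsuffix s (isNode_map_inl_append_inr_iff.1 he) le_rfl).imp
      fun _ => isNode_map_inl_append_inr_iff.2
  refine ⟨hnode s (Nat.le_succ _) h.1, ?_⟩
  rcases h.2 with hroot | hleaf | ⟨a | a, b | b, hab, ha, hb⟩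
  · exact Or.inl (by simpa using hroot)
  · exact absurd h.1.exists_append_of_map_inl hleaf
  · exact Or.inr (Or.inr ⟨_, _, fun h => hab (congrArg _ (Sum.inl.inj h)), hinl a ha, hinl b hb⟩)
  · obtain ⟨k, hk⟩ := hinr b hb
    exact Or.inr (Or.inr ⟨_, _, Sum.inl_ne_inr, hinl a ha, hk⟩)
  · obtain ⟨k, hk⟩ := hinr a ha
    exact Or.inr (Or.inr ⟨_, _, Sum.inr_ne_inl, hk, hinl b hb⟩)
  · exact absurd (congrArg Sum.inr (Subsingleton.elim a b)) hab

theorem SameEdge.of_covers {w s₁ s₂ : List σ} (hcov : Covers docs w s₂.length)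
    (h : SameEdge docs s₁ s₂) : SameEdge (fun _ : Fin 1 => w) s₁ s₂ :=
  ⟨h.1, fun r h₁ h₂ hr => h.2 r h₁ h₂ (hr.of_covers (hcov.mono h₂.length_le))⟩

theorem exists_pointsTo_of_pointsTo {w : List σ} (ptr' : List (σ ⊕ Fin 1) → ℕ) (X : Set (List σ))
    (hptr : Set.InjOn ptr {x | IsExplicit docs x}) (hX : ∀ s ∈ X, s <:+: w)
    (hcov : ∀ s₁ ∈ X, ∀ s₂ ∈ X, s₁.length < s₂.length → Covers docs w s₂.length)
    {kind p : ℕ} (hne : ∃ s ∈ X, PointsTo docs ptr s kind p) :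
    ∃ kind' p', (∃ s, PointsTo (fun _ : Fin 1 => w) ptr' s kind' p') ∧
      ∀ s ∈ X, PointsTo docs ptr s kind p → PointsTo (fun _ : Fin 1 => w) ptr' s kind' p' := by
  obtain ⟨s₂, ⟨hs₂, h₂⟩, hmax⟩ := exists_longest (S := {s ∈ X | PointsTo docs ptr s kind p}) hne
    fun s hs => (hX s hs.1).length_le
  obtain ⟨kind', p', hw⟩ :=
    (isNode_map_inl_iff (docs := fun _ => w).2 ⟨0, hX s₂ hs₂⟩).exists_pointsTo ptr'
  refine ⟨kind', p', ⟨s₂, hw⟩, fun s₁ hs₁ h₁ => ?_⟩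
  have hle := hmax s₁ ⟨hs₁, h₁⟩
  rcases h₁.eq_or_sameEdge hptr h₂ hle with rfl | hedge
  · exact hw
  rcases hle.eq_or_lt with heq | hlt
  · rwa [hedge.1.eq_of_length heq]
  · exact (hedge.of_covers (hcov s₁ hs₁ s₂ hs₂ hlt)).pointsTo hw

end Nodes

/-! ### The number of explicit nodes -/

section Count

/-- The branching nodes of the trie of a set of strings. They are counted by inserting the strings
one by one. -/
def branchings {α : Type*} (L : Set (List α)) : Set (List α) :=
  {x | ∃ a b, a ≠ b ∧ (∃ y ∈ L, x ++ [a] <+: y) ∧ ∃ y ∈ L, x ++ [b] <+: y}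

theorem exists_fork_of_mem_branchings_insert {α : Type*} {L : Set (List α)} {x y : List α}
    (hx : x ∈ branchings (insert y L) \ branchings L) :
    ∃ a b, a ≠ b ∧ x ++ [a] <+: y ∧ ∃ z ∈ L, x ++ [b] <+: z := by
  obtain ⟨⟨a, b, hab, ⟨y₁, rfl | h₁, ha⟩, y₂, rfl | h₂, hb⟩, hnot⟩ := hx
  · have heq := (List.prefix_of_prefix_length_le ha hb (by simp)).eq_of_length (by simp)
    exact absurd (by simpa using heq) hab
  · exact ⟨a, b, hab, ha, y₂, h₂, hb⟩
  · exact ⟨b, a, hab.symm, hb, y₁, h₁, ha⟩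
  · exact absurd ⟨a, b, hab, ⟨y₁, h₁, ha⟩, y₂, h₂, hb⟩ hnot

theorem subsingleton_branchings_insert_diff {α : Type*} (L : Set (List α)) (y : List α) :
    (branchings (insert y L) \ branchings L).Subsingleton := by
  have hle : ∀ x₁ ∈ branchings (insert y L) \ branchings L,
      ∀ x₂ ∈ branchings (insert y L) \ branchings L, x₂.length ≤ x₁.length := by
    intro x₁ h₁ x₂ h₂
    by_contra! hlt
    obtain ⟨a, b, hab, ha, hb⟩ := exists_fork_of_mem_branchings_insert h₁
    obtain ⟨a', b', -, ha', z, hz, hb'⟩ := exists_fork_of_mem_branchings_insert h₂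
    have hpre : x₁ ++ [a] <+: x₂ := List.prefix_of_prefix_length_le ha
      ((List.prefix_append _ _).trans ha') (by simpa using hlt)
    exact h₁.2 ⟨a, b, hab, ⟨z, hz, hpre.trans ((List.prefix_append _ _).trans hb')⟩, hb⟩
  intro x₁ h₁ x₂ h₂
  obtain ⟨a, -, -, ha, -⟩ := exists_fork_of_mem_branchings_insert h₁
  obtain ⟨a', -, -, ha', -⟩ := exists_fork_of_mem_branchings_insert h₂
  exact (List.prefix_of_prefix_length_le ((List.prefix_append _ _).trans ha)
    ((List.prefix_append _ _).trans ha') (hle x₂ h₂ x₁ h₁)).eq_of_length_le (hle x₁ h₁ x₂ h₂)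

theorem encard_branchings_le {α : Type*} (L : Set (List α)) :
    (branchings L).encard ≤ L.encard := by
  rcases L.finite_or_infinite with hL | hL
  · induction L, hL using Set.Finite.induction_on with
    | empty => simp [branchings]
    | @insert y L hy _ ih =>
      calc (branchings (insert y L)).encard
          ≤ (branchings (insert y L) \ branchings L).encard + (branchings L).encard :=
            Set.encard_le_encard_sdiff_add_encard _ _
        _ ≤ 1 + L.encard := add_le_add
            (Set.encard_le_one_iff_subsingleton.2 (subsingleton_branchings_insert_diff L y)) ih
        _ = (insert y L).encard := by rw [Set.encard_insert_of_notMem hy, add_comm]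
  · simp [hL.encard_eq]

variable {σ : Type*} {β : ℕ} {docs : Fin β → List σ} {ptr : List (σ ⊕ Fin β) → ℕ}

theorem IsExplicit.suffix_or_mem_branchings {x : List (σ ⊕ Fin β)} (h : IsExplicit docs x) :
    (∃ i, x <:+ terminated docs i) ∨ x ∈ branchings {y | ∃ i, y <:+ terminated docs i} := by
  obtain ⟨⟨i, y, hy, z, rfl⟩, rfl | hleaf | ⟨a, b, hab, ⟨i₁, y₁, hy₁, ha⟩, i₂, y₂, hy₂, hb⟩⟩ := h
  · exact Or.inl ⟨i, List.nil_suffix⟩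
  · cases z with
    | nil => exact Or.inl ⟨i, by simpa using hy⟩
    | cons a z => exact absurd ⟨a, i, _, hy, z, by simp⟩ hleaf
  · exact Or.inr ⟨a, b, hab, ⟨y₁, ⟨i₁, hy₁⟩, ha⟩, y₂, ⟨i₂, hy₂⟩, hb⟩

theorem encard_suffixes_terminated_le (docs : Fin β → List σ) :
    {y | ∃ i, y <:+ terminated docs i}.encard ≤ (∑ i, ((docs i).length + 2) : ℕ) := by
  classical
  have hcoe : {y | ∃ i, y <:+ terminated docs i} =
      ((Finset.univ.biUnion fun i => (terminated docs i).tails.toFinset : Finset _) : Set _) := by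
    ext y; simp
  rw [hcoe, Set.encard_coe_eq_coe_finsetCard, Nat.cast_le]
  exact Finset.card_biUnion_le.trans <| Finset.sum_le_sum fun i _ =>
    (List.toFinset_card_le _).trans (by simp [terminated])

theorem encard_isExplicit_le (docs : Fin β → List σ) :
    {x | IsExplicit docs x}.encard ≤ (2 * ∑ i, ((docs i).length + 2) : ℕ) := by
  have hle := encard_suffixes_terminated_le docs
  calc {x | IsExplicit docs x}.encard
      ≤ {y | ∃ i, y <:+ terminated docs i}.encard +
          (branchings {y | ∃ i, y <:+ terminated docs i}).encard :=
        (Set.encard_le_encard fun _ hx => hx.suffix_or_mem_branchings).trans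
          (Set.encard_union_le _ _)
    _ ≤ (∑ i, ((docs i).length + 2) : ℕ) + (∑ i, ((docs i).length + 2) : ℕ) :=
        add_le_add hle ((encard_branchings_le _).trans hle)
    _ = (2 * ∑ i, ((docs i).length + 2) : ℕ) := by rw [two_mul, Nat.cast_add]

theorem exists_isPointerMap (docs : Fin β → List σ) : ∃ ptr, IsPointerMap docs ptr := by
  have hfin : {x | IsExplicit docs x}.Finite :=
    Set.finite_of_encard_le_coe (encard_isExplicit_le docs)
  obtain ⟨ptr, hptr⟩ := hfin.exists_bijOn_of_encard_eq
    (t := Set.Iio {x | IsExplicit docs x}.ncard) (by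
      rw [← Finset.coe_Iio, Set.encard_coe_eq_coe_finsetCard, Nat.card_Iio, hfin.cast_ncard_eq])
  exact ⟨ptr, _, hptr⟩

theorem IsPointerMap.injOn (h : IsPointerMap docs ptr) : Set.InjOn ptr {x | IsExplicit docs x} :=
  h.choose_spec.injOn

theorem IsPointerMap.lt (h : IsPointerMap docs ptr) {x : List (σ ⊕ Fin β)}
    (hx : IsExplicit docs x) : ptr x < 2 * ∑ i, ((docs i).length + 2) := by
  obtain ⟨N, hN⟩ := h
  have hle := encard_isExplicit_le docs
  rw [← hN.injOn.encard_image, hN.image_eq, ← Finset.coe_Iio, Set.encard_coe_eq_coe_finsetCard,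
    Nat.card_Iio, Nat.cast_le] at hle
  exact (hN.mapsTo hx).trans_le hle

theorem PointsTo.lt {s : List σ} {kind p : ℕ} (h : PointsTo docs ptr s kind p)
    (hptr : IsPointerMap docs ptr) : p < 2 * ∑ i, ((docs i).length + 2) := by
  rcases h with ⟨hx, -, rfl⟩ | ⟨-, -, u, v, he, -, -, rfl⟩
  · exact hptr.lt hx
  · exact hptr.lt he.2.1

end Count

/-! ### Simulating a program with shorter words -/

section Run

variable {W : ℕ} {P : List Instr} {D : List ℕ} {s : Config}

theorem step_of_getElem? {ins : Instr} (h : P[s.pc]? = some ins) :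
    step W P D s = ins.exec W D s := by
  simp only [step, h]

theorem step_of_length_le (h : P.length ≤ s.pc) : step W P D s = s := by
  simp only [step, List.getElem?_eq_none h]

theorem iterate_step_of_halted {k T : ℕ} (hk : k ≤ T)
    (h : P.length ≤ ((step W P D)^[k] s).pc) : (step W P D)^[T] s = (step W P D)^[k] s := by
  obtain ⟨m, rfl⟩ := Nat.exists_eq_add_of_le' hk
  rw [Function.iterate_add_apply]
  exact Function.iterate_fixed (step_of_length_le h) m

/-- Instructions other than jumps; they advance the program counter by one. -/
def Instr.IsStraight : Instr → Prop
  | .jumpLt _ _ _ => False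
  | _ => True

theorem Instr.IsStraight.pc_exec {ins : Instr} (h : ins.IsStraight) :
    (ins.exec W D s).pc = s.pc + 1 := by
  cases ins with
  | jumpLt => exact h.elim
  | _ => rfl

/-- The effect of executing a list of instructions one after the other, whatever the program counter
says. -/
def execBlock (W : ℕ) (D : List ℕ) (s : Config) (code : List Instr) : Config :=
  code.foldl (fun s ins => ins.exec W D s) s

theorem iterate_step_eq_execBlock (code : List Instr)
    (hcode : ∀ ins ∈ code.dropLast, ins.IsStraight) (pre post : List Instr)
    (hs : s.pc = pre.length) :
    (step W (pre ++ code ++ post) D)^[code.length] s = execBlock W D s code := by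
  induction code generalizing pre s with
  | nil => rfl
  | cons ins code ih =>
    rw [List.length_cons, Function.iterate_succ_apply,
      step_of_getElem? (ins := ins) (by rw [hs]; simp)]
    rcases code with _ | ⟨ins', code⟩
    · rfl
    rw [List.dropLast_cons_cons, List.forall_mem_cons] at hcode
    have hrun := ih hcode.2 (pre ++ [ins]) (s := ins.exec W D s)
      (by rw [hcode.1.pc_exec, hs, List.length_append, List.length_singleton])
    simpa [execBlock] using hrun

end Run

theorem WordOp.eval_lt {W : ℕ} (o : WordOp) {a b : ℕ} (ha : a < 2 ^ W) (hb : b < 2 ^ W) :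
    o.eval W a b < 2 ^ W := by
  cases o
  case add | sub | mul | shl => exact Nat.mod_lt _ (by positivity)
  case div | shr => exact (Nat.div_le_self _ _).trans_lt ha
  case mod => exact (Nat.mod_le _ _).trans_lt ha
  case and => exact Nat.and_lt_two_pow _ hb
  case or => exact Nat.or_lt_two_pow ha hb
  case xor => exact Nat.xor_lt_two_pow ha hb

theorem WordOp.eval_mod_two_pow {W W' : ℕ} (hW : W' ≤ W) (o : WordOp) {a b : ℕ}
    (ha : a < 2 ^ W') (hb : b < 2 ^ W') : o.eval W a b % 2 ^ W' = o.eval W' a b := by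
  have hdvd : 2 ^ W' ∣ 2 ^ W := pow_dvd_pow 2 hW
  cases o
  case add | mul | shl => exact Nat.mod_mod_of_dvd _ hdvd
  case sub =>
    obtain ⟨e, he⟩ := (Nat.dvd_sub hdvd dvd_rfl : 2 ^ W' ∣ 2 ^ W - 2 ^ W')
    have hle : 2 ^ W' ≤ 2 ^ W := Nat.pow_le_pow_right Nat.two_pos hW
    have hsplit : a + (2 ^ W - b) = a + (2 ^ W' - b) + 2 ^ W' * e := by omega
    simp only [WordOp.eval]
    rw [Nat.mod_mod_of_dvd _ hdvd, hsplit, Nat.add_mul_mod_self_left]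
  case div => exact Nat.mod_eq_of_lt (WordOp.eval_lt .div ha hb)
  case mod => exact Nat.mod_eq_of_lt (WordOp.eval_lt .mod ha hb)
  case and => exact Nat.mod_eq_of_lt (WordOp.eval_lt .and ha hb)
  case or => exact Nat.mod_eq_of_lt (WordOp.eval_lt .or ha hb)
  case xor => exact Nat.mod_eq_of_lt (WordOp.eval_lt .xor ha hb)
  case shr => exact Nat.mod_eq_of_lt (WordOp.eval_lt .shr ha hb)

/-- The memory `D` of a machine with `W`-bit words consists of `G` interleaved lists, the tracks:
cell `a` of track `c` is cell `a * G + c` of `D`. As reading a track beyond its end then gives `0`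
too, a machine with `W'`-bit words can be simulated on each track without storing lengths. -/
structure IsInterleaved (W W' G : ℕ) (D : List ℕ) (track : ℕ → List ℕ) : Prop where
  mul_le : G * 2 ^ W' ≤ 2 ^ W
  getD_eq : ∀ c < G, ∀ a, D.getD (a * G + c) 0 = (track c).getD a 0

theorem IsInterleaved.getD_mod {W W' G : ℕ} {D : List ℕ} {track : ℕ → List ℕ}
    (h : IsInterleaved W W' G D track) {a c : ℕ} (ha : a < 2 ^ W') (hc : c < G) :
    D.getD ((a * G + c) % 2 ^ W) 0 = (track c).getD a 0 := by
  have hlt : a * G + c < 2 ^ W :=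
    calc a * G + c < (a + 1) * G := by rw [add_one_mul]; omega
      _ ≤ 2 ^ W' * G := Nat.mul_le_mul_right G ha
      _ ≤ 2 ^ W := by rw [mul_comm]; exact h.mul_le
  rw [Nat.mod_eq_of_lt hlt, h.getD_eq c hc]

theorem IsInterleaved.width_le {W W' G : ℕ} {D : List ℕ} {track : ℕ → List ℕ}
    (h : IsInterleaved W W' G D track) (hG : 0 < G) : W' ≤ W :=
  (Nat.pow_le_pow_iff_right Nat.one_lt_two).1 ((Nat.le_mul_of_pos_left _ hG).trans h.mul_le)

/-- Register `5` holding the number of tracks, reads cell `a` of track `c` into register `d`, where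
`a` and `c` are given in registers. Register `6` is overwritten. -/
def fetch (d a c : ℕ) : List Instr :=
  [.binop .mul 6 a 5, .binop .add 6 6 c, .load d 6]

theorem execBlock_fetch {W : ℕ} {D : List ℕ} {s : Config} {d a c : ℕ} (hc : c ≠ 6) :
    execBlock W D s (fetch d a c) = ⟨s.pc + 3, Function.update
      (Function.update s.reg 6 ((s.reg a * s.reg 5 + s.reg c) % 2 ^ W)) d
      (D.getD ((s.reg a * s.reg 5 + s.reg c) % 2 ^ W) 0)⟩ := by
  simp [execBlock, fetch, Instr.exec, WordOp.eval, Function.update_of_ne hc]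

/-- The code that simulates one instruction of a machine with `W'`-bit words, whose memory is a
track. Register `r` of the simulated machine is kept in register `r + 8`; registers `3`, `4` and `5`
hold `2 ^ W'`, the number of the track and the number of tracks. The function `tgt` translates jump
targets. Writing to register `6`, which is never read, pads every block to length `3`. -/
def simBlock (tgt : ℕ → ℕ) : Instr → List Instr
  | .const d c => [.const 6 0, .const (d + 8) c, .binop .mod (d + 8) (d + 8) 3]
  | .binop o d a b =>
    [.const 6 0, .binop o (d + 8) (a + 8) (b + 8), .binop .mod (d + 8) (d + 8) 3]
  | .load d a => fetch (d + 8) (a + 8) 4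
  | .jumpLt a b t => [.const 6 0, .const 6 0, .jumpLt (a + 8) (b + 8) (tgt t)]

/-- The code that simulates a program, to be placed at address `start`. When the simulated program
halts, control passes to the end of this code. -/
def simCode (start : ℕ) (P : List Instr) : List Instr :=
  P.flatMap (simBlock fun t => start + 3 * min t P.length)

theorem length_simBlock (tgt : ℕ → ℕ) (ins : Instr) : (simBlock tgt ins).length = 3 := by
  cases ins <;> rfl

theorem length_flatMap_simBlock (tgt : ℕ → ℕ) (P : List Instr) :
    (P.flatMap (simBlock tgt)).length = 3 * P.length := by
  simp [List.length_flatMap, length_simBlock, mul_comm]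

theorem isStraight_of_mem_dropLast_simBlock {tgt : ℕ → ℕ} {ins : Instr} :
    ∀ i ∈ (simBlock tgt ins).dropLast, i.IsStraight := by
  cases ins <;> simp [simBlock, fetch, Instr.IsStraight]

theorem exists_simCode_eq_append {P : List Instr} {n : ℕ} (hn : n < P.length) (start : ℕ) :
    ∃ pre post, pre.length = 3 * n ∧ simCode start P =
      pre ++ simBlock (fun t => start + 3 * min t P.length) P[n] ++ post := by
  set block := simBlock fun t => start + 3 * min t P.length with hblock
  refine ⟨(P.take n).flatMap block, (P.drop (n + 1)).flatMap block, ?_, ?_⟩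
  · rw [length_flatMap_simBlock, List.length_take_of_le hn.le]
  · conv_lhs => rw [simCode, ← hblock, ← List.take_append_drop n P, List.drop_eq_getElem_cons hn,
      List.flatMap_append, List.flatMap_cons, ← List.append_assoc]

/-- The state `s'` of the simulating machine, whose simulating code starts at address `start`,
represents the state `s` of a machine with `W'`-bit words that runs a program of length `len` on
track `c` of `G` tracks. -/
structure Simulates (W' G c start len : ℕ) (s s' : Config) : Prop where
  pc : s'.pc = start + 3 * min s.pc len
  reg : ∀ r, s'.reg (r + 8) = s.reg r
  lt : ∀ r, s.reg r < 2 ^ W'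
  modulus : s'.reg 3 = 2 ^ W'
  track : s'.reg 4 = c
  stride : s'.reg 5 = G

section Simulation

variable {W W' G c start len : ℕ} {P : List Instr} {D : List ℕ} {track : ℕ → List ℕ}
  {s s' t' : Config}

theorem Simulates.update (h : Simulates W' G c start len s s') (hpc : s.pc < len) {d x : ℕ}
    (hx : x < 2 ^ W') (hpc' : t'.pc = s'.pc + 3) (hd : t'.reg (d + 8) = x)
    (hreg : ∀ r, 3 ≤ r → r ≠ 6 → r ≠ d + 8 → t'.reg r = s'.reg r) :
    Simulates W' G c start len ⟨s.pc + 1, Function.update s.reg d x⟩ t' where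
  pc := by rw [hpc', h.pc, min_eq_left hpc.le, min_eq_left (Nat.succ_le_of_lt hpc)]; rfl
  reg r := by
    rcases eq_or_ne r d with rfl | hr
    · simp only [hd, Function.update_self]
    · rw [hreg _ (by omega) (by omega) (by omega), h.reg]; exact (Function.update_of_ne hr ..).symm
  lt r := by
    rcases eq_or_ne r d with rfl | hr
    · simpa only [Function.update_self] using hx
    · simpa only [Function.update_of_ne hr] using h.lt r
  modulus := (hreg 3 (by omega) (by omega) (by omega)).trans h.modulus
  track := (hreg 4 (by omega) (by omega) (by omega)).trans h.track
  stride := (hreg 5 (by omega) (by omega) (by omega)).trans h.stride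

theorem getD_zero_lt {l : List ℕ} {B : ℕ} (hB : 0 < B) (h : ∀ x ∈ l, x < B) (a : ℕ) :
    l.getD a 0 < B := by
  rcases lt_or_ge a l.length with ha | ha
  · rw [List.getD_eq_getElem _ _ ha]
    exact h _ (List.getElem_mem ha)
  · rwa [List.getD_eq_default _ _ ha]

theorem Simulates.execBlock_simBlock (hD : IsInterleaved W W' G D track) (hc : c < G)
    (hlt : ∀ x ∈ track c, x < 2 ^ W') (h : Simulates W' G c start len s s') (hpc : s.pc < len)
    (ins : Instr) : Simulates W' G c start len (ins.exec W' (track c) s)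
      (execBlock W D s' (simBlock (fun t => start + 3 * min t len) ins)) := by
  have hW := hD.width_le (Nat.zero_lt_of_lt hc)
  cases ins with
  | const d x =>
    refine h.update hpc (Nat.mod_lt _ (by positivity)) rfl ?_ fun _ _ h6 hd => ?_
    · simp [execBlock, simBlock, Instr.exec, WordOp.eval, h.modulus,
        Nat.mod_mod_of_dvd _ (pow_dvd_pow 2 hW)]
    · simp [execBlock, simBlock, Instr.exec, hd, h6]
  | binop o d a b =>
    refine h.update hpc (o.eval_lt (h.lt a) (h.lt b)) rfl ?_ fun _ _ h6 hd => ?_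
    · rw [← o.eval_mod_two_pow hW (h.lt a) (h.lt b), ← h.reg, ← h.reg, ← h.modulus]
      simp [execBlock, simBlock, Instr.exec, WordOp.eval]
    · simp [execBlock, simBlock, Instr.exec, hd, h6]
  | load d a =>
    rw [simBlock, execBlock_fetch (by norm_num)]
    refine h.update hpc (getD_zero_lt (by positivity) hlt _) rfl ?_ fun _ _ h6 hd => ?_
    · simp only [Function.update_self]
      rw [h.reg, h.track, h.stride, hD.getD_mod (h.lt a) hc]
    · simp only [Function.update_of_ne hd, Function.update_of_ne h6]
  | jumpLt a b t =>
    have hreg : ∀ r, r ≠ 6 → (execBlock W D s' (simBlock (fun t => start + 3 * min t len)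
        (.jumpLt a b t))).reg r = s'.reg r := fun r hr => by
      simp [execBlock, simBlock, Instr.exec, hr]
    refine ⟨?_, fun r => (hreg _ (by omega)).trans (h.reg r), h.lt,
      (hreg 3 (by norm_num)).trans h.modulus, (hreg 4 (by norm_num)).trans h.track,
      (hreg 5 (by norm_num)).trans h.stride⟩
    by_cases hab : s.reg a < s.reg b
    · simp [execBlock, simBlock, Instr.exec, h.reg, hab]
    · simp only [execBlock, simBlock, Instr.exec, List.foldl_cons, List.foldl_nil, h.pc,
        Function.update_idem, ne_eq, Nat.reduceEqDiff, not_false_eq_true, Function.update_of_ne,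
        h.reg, hab, ↓reduceIte]
      omega

theorem Simulates.exists_step (hD : IsInterleaved W W' G D track) (hc : c < G)
    (hlt : ∀ x ∈ track c, x < 2 ^ W') {pre post : List Instr}
    (h : Simulates W' G c pre.length P.length s s') :
    ∃ k ≤ 3, Simulates W' G c pre.length P.length (step W' P (track c) s)
      ((step W (pre ++ simCode pre.length P ++ post) D)^[k] s') := by
  rcases le_or_gt P.length s.pc with hpc | hpc
  · exact ⟨0, Nat.zero_le _, by rwa [step_of_length_le hpc]⟩
  obtain ⟨pre', post', hlen, heq⟩ := exists_simCode_eq_append hpc pre.length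
  have hrun := iterate_step_eq_execBlock (W := W) (D := D) (s := s')
    (simBlock (fun t => pre.length + 3 * min t P.length) P[s.pc])
    isStraight_of_mem_dropLast_simBlock (pre ++ pre') (post' ++ post)
    (by rw [h.pc, min_eq_left hpc.le, List.length_append, hlen])
  have hprog : pre ++ simCode pre.length P ++ post = pre ++ pre' ++
      simBlock (fun t => pre.length + 3 * min t P.length) P[s.pc] ++ (post' ++ post) := by
    simp only [heq, List.append_assoc]
  rw [length_simBlock, ← hprog] at hrun
  refine ⟨3, le_rfl, ?_⟩
  rw [step_of_getElem? (List.getElem?_eq_getElem hpc), hrun]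
  exact h.execBlock_simBlock hD hc hlt hpc _

theorem Simulates.exists_iterate (hD : IsInterleaved W W' G D track) (hc : c < G)
    (hlt : ∀ x ∈ track c, x < 2 ^ W') {pre post : List Instr}
    (h : Simulates W' G c pre.length P.length s s') (T : ℕ) :
    ∃ k ≤ 3 * T, Simulates W' G c pre.length P.length ((step W' P (track c))^[T] s)
      ((step W (pre ++ simCode pre.length P ++ post) D)^[k] s') := by
  induction T with
  | zero => exact ⟨0, le_rfl, h⟩
  | succ T ih =>
    obtain ⟨k, hk, hsim⟩ := ih
    obtain ⟨m, hm, hsim⟩ := hsim.exists_step (post := post) hD hc hlt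
    refine ⟨m + k, by omega, ?_⟩
    rwa [Function.iterate_succ_apply', Function.iterate_add_apply]

end Simulation

/-! ### The query program -/

/-- The part of the query program that, on input `i`, `j`, looks up the number `b` of the first
track of the scale of the length of the query, and sets up the simulation on track `b + 2` of the
query `k`, `o`, `o + (j - i)`, where `k` and `o` are the entries `i` of tracks `b` and `b + 1`. -/
def prologue : List Instr :=
  [.load 5 2, .const 7 1, .load 3 7, .binop .sub 2 1 0, .const 4 2] ++ fetch 4 2 4 ++
    fetch 8 0 4 ++ [.binop .add 4 4 7] ++ fetch 9 0 4 ++ [.binop .add 10 9 2, .binop .add 4 4 7]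

/-- The part of the query program that translates the answer `(kind, p)` of the simulated program
by means of the entries `2 * p + kind` of the two tracks that follow its memory. -/
def epilogue : List Instr :=
  [.binop .add 2 9 9, .binop .add 2 2 8, .const 7 1, .binop .add 4 4 7] ++ fetch 0 2 4 ++
    [.binop .add 4 4 7] ++ fetch 1 2 4

/-- The query program for general substring retrieval, `P` being that for long substring
retrieval. -/
def queryProgram (P : List Instr) : List Instr :=
  prologue ++ simCode prologue.length P ++ epilogue

section QueryProgram

variable {W W' G : ℕ} {D : List ℕ} {track : ℕ → List ℕ}

theorem IsInterleaved.mod_eq (hD : IsInterleaved W W' G D track) {x : ℕ} (hG : 0 < G)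
    (hx : x < 2 ^ W') : x % 2 ^ W = x :=
  Nat.mod_eq_of_lt (hx.trans_le (Nat.pow_le_pow_right Nat.two_pos (hD.width_le hG)))

theorem IsInterleaved.track_mod_eq (hD : IsInterleaved W W' G D track) {c : ℕ} (hc : c < G) :
    c % 2 ^ W = c :=
  Nat.mod_eq_of_lt (hc.trans_le ((Nat.le_mul_of_pos_right _ (by positivity)).trans hD.mul_le))

theorem reg_execBlock_prologue (hD : IsInterleaved W W' G D track) {i j b k o : ℕ}
    (hstride : (track 0).getD 0 0 = G) (hmodulus : (track 1).getD 0 0 = 2 ^ W') (hb : b + 2 < G)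
    (hscale : (track 2).getD (j - i) 0 = b) (hdoc : (track b).getD i 0 = k)
    (hoffset : (track (b + 1)).getD i 0 = o) (hij : i ≤ j) (hj : j < 2 ^ W')
    (ho : o + (j - i) < 2 ^ W') {r : ℕ} (h3 : 3 ≤ r) (h6 : r ≠ 6) (h7 : r ≠ 7) :
    (execBlock W D (initConfig [i, j]) prologue).reg r =
      Function.update (Function.update (Function.update (Function.update (Function.update
        (Function.update (initConfig [i, j]).reg 3 (2 ^ W')) 4 (b + 2)) 5 G) 8 k) 9 o) 10
          (o + (j - i)) r := by
  have hG : 0 < G := by omega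
  have hD0 : D.getD 0 0 = G := by simpa only [zero_mul, hstride] using hD.getD_eq 0 hG 0
  have hD1 : D.getD 1 0 = 2 ^ W' := by
    simpa only [zero_mul, zero_add, hmodulus] using hD.getD_eq 1 (by omega) 0
  have hone : 1 % 2 ^ W = 1 := hD.track_mod_eq (by omega)
  have htwo : 2 % 2 ^ W = 2 := hD.track_mod_eq (by omega)
  have hsub : (j + (2 ^ W - i)) % 2 ^ W = j - i := by
    have hle : 2 ^ W' ≤ 2 ^ W := Nat.pow_le_pow_right Nat.two_pos (hD.width_le hG)
    rw [show j + (2 ^ W - i) = j - i + 2 ^ W by omega, Nat.add_mod_right,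
      hD.mod_eq hG (by omega)]
  have hDb := hD.getD_mod (a := j - i) (c := 2) (by omega) (by omega)
  have hDk := hD.getD_mod (a := i) (c := b) (by omega) (by omega)
  have hDo := hD.getD_mod (a := i) (c := b + 1) (by omega) (by omega)
  have hb1 : (b + 1) % 2 ^ W = b + 1 := hD.track_mod_eq (by omega)
  have hb2 : (b + 1 + 1) % 2 ^ W = b + 2 := hD.track_mod_eq hb
  have hsum := hD.mod_eq hG ho
  rw [hscale] at hDb
  rw [hdoc] at hDk
  rw [hoffset] at hDo
  have hinit0 : (initConfig [i, j]).reg 0 = i := rfl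
  have hinit1 : (initConfig [i, j]).reg 1 = j := rfl
  have hinit2 : (initConfig [i, j]).reg 2 = 0 := rfl
  simp only [prologue, fetch, execBlock, Instr.exec, WordOp.eval, List.foldl_cons, List.foldl_nil,
    List.cons_append, List.nil_append, Function.update_self, Function.update_of_ne, ne_eq,
    Nat.reduceEqDiff, not_false_eq_true, Nat.mod_add_mod, *]
  simp only [Function.update_apply]
  split_ifs <;> first | rfl | omega

theorem simulates_execBlock_prologue (hD : IsInterleaved W W' G D track) {i j b k o : ℕ} (len : ℕ)
    (hstride : (track 0).getD 0 0 = G) (hmodulus : (track 1).getD 0 0 = 2 ^ W') (hb : b + 2 < G)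
    (hscale : (track 2).getD (j - i) 0 = b) (hdoc : (track b).getD i 0 = k)
    (hoffset : (track (b + 1)).getD i 0 = o) (hij : i ≤ j) (hj : j < 2 ^ W') (hk : k < 2 ^ W')
    (ho : o + (j - i) < 2 ^ W') :
    Simulates W' G (b + 2) prologue.length len (initConfig [k, o, o + (j - i)])
      (execBlock W D (initConfig [i, j]) prologue) := by
  have hrun := fun r => reg_execBlock_prologue (r := r) hD hstride hmodulus hb hscale hdoc hoffset
    hij hj ho
  exact
    { pc := by simp [prologue, fetch, execBlock, Instr.exec, initConfig]
      reg := by rintro (_ | _ | _ | _) <;> rw [hrun _ (by omega) (by omega) (by omega)] <;> rfl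
      lt := by
        rintro (_ | _ | _ | _)
        · exact hk
        · exact (Nat.le_add_right _ _).trans_lt ho
        · exact ho
        · exact Nat.two_pow_pos W'
      modulus := hrun 3 (by omega) (by omega) (by omega)
      track := hrun 4 (by omega) (by omega) (by omega)
      stride := hrun 5 (by omega) (by omega) (by omega) }

theorem execBlock_epilogue (hD : IsInterleaved W W' G D track) {s : Config} {b kind p : ℕ}
    (hb : b + 4 < G) (hkind : s.reg 8 = kind) (hp : s.reg 9 = p) (htrack : s.reg 4 = b + 2)
    (hstride : s.reg 5 = G) (hlt : 2 * p + kind < 2 ^ W') :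
    (execBlock W D s epilogue).reg 0 = (track (b + 3)).getD (2 * p + kind) 0 ∧
      (execBlock W D s epilogue).reg 1 = (track (b + 4)).getD (2 * p + kind) 0 := by
  have hG : 0 < G := by omega
  have hone : 1 % 2 ^ W = 1 := hD.track_mod_eq (by omega)
  have hpp : (p + p) % 2 ^ W = 2 * p := by rw [← two_mul, hD.mod_eq hG (by omega)]
  have hindex := hD.mod_eq hG hlt
  have hb3 : (b + 2 + 1) % 2 ^ W = b + 3 := hD.track_mod_eq (by omega)
  have hb4 : (b + 3 + 1) % 2 ^ W = b + 4 := hD.track_mod_eq hb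
  rw [← hD.getD_mod hlt (by omega), ← hD.getD_mod hlt (by omega)]
  constructor <;>
    simp only [epilogue, fetch, execBlock, Instr.exec, WordOp.eval, List.foldl_cons, List.foldl_nil,
      List.cons_append, List.nil_append, Function.update_self, Function.update_of_ne, ne_eq,
      Nat.reduceEqDiff, not_false_eq_true, OfNat.ofNat_ne_zero, OfNat.zero_ne_ofNat, zero_ne_one,
      Nat.mod_add_mod, *]

theorem answers_queryProgram (hD : IsInterleaved W W' G D track) {P : List Instr}
    {i j b k o T : ℕ} {good good' : ℕ → ℕ → Prop} (hstride : (track 0).getD 0 0 = G)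
    (hmodulus : (track 1).getD 0 0 = 2 ^ W') (hb : b + 4 < G)
    (hscale : (track 2).getD (j - i) 0 = b) (hdoc : (track b).getD i 0 = k)
    (hoffset : (track (b + 1)).getD i 0 = o) (hdata : ∀ x ∈ track (b + 2), x < 2 ^ W')
    (hij : i ≤ j) (hj : j < 2 ^ W') (hk : k < 2 ^ W') (ho : o + (j - i) < 2 ^ W')
    (hP : Answers W' P T (track (b + 2)) [k, o, o + (j - i)] good)
    (hgood : ∀ kind p, good kind p → 2 * p + kind < 2 ^ W' ∧
      good' ((track (b + 3)).getD (2 * p + kind) 0) ((track (b + 4)).getD (2 * p + kind) 0)) :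
    Answers W (queryProgram P) (28 + 3 * T) D [i, j] good' := by
  have hinit := iterate_step_eq_execBlock (W := W) (D := D) (s := initConfig [i, j]) prologue
    (by simp [prologue, fetch, Instr.IsStraight]) [] (simCode prologue.length P ++ epilogue) rfl
  obtain ⟨m, hm, hsim⟩ := (simulates_execBlock_prologue hD P.length hstride hmodulus (by omega)
    hscale hdoc hoffset hij hj hk ho).exists_iterate (post := epilogue) hD (by omega) hdata T
  rw [List.nil_append, ← List.append_assoc] at hinit
  rw [← hinit, ← Function.iterate_add_apply, ← queryProgram] at hsim
  obtain ⟨hhalted, hanswer⟩ := hP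
  obtain ⟨hlt, hanswer'⟩ := hgood _ _ hanswer
  set s := (step W (queryProgram P) D)^[m + prologue.length] (initConfig [i, j]) with hs
  have hpc : s.pc = (prologue ++ simCode prologue.length P).length := by
    rw [hsim.pc, min_eq_right hhalted, List.length_append, simCode, length_flatMap_simBlock]
  have hfinal := iterate_step_eq_execBlock (W := W) (D := D) epilogue
    (by simp [epilogue, fetch, Instr.IsStraight]) _ [] hpc
  rw [List.append_nil, ← queryProgram, hs, ← Function.iterate_add_apply] at hfinal
  have hend : (queryProgram P).length ≤ (execBlock W D s epilogue).pc := by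
    change _ ≤ s.pc + epilogue.length
    rw [hpc, queryProgram, List.length_append]
  obtain ⟨hreg0, hreg1⟩ := execBlock_epilogue hD hb (hsim.reg 0) (hsim.reg 1) hsim.track
    hsim.stride hlt
  have hle : epilogue.length + (m + prologue.length) ≤ 28 + 3 * T := by
    simp only [epilogue, prologue, fetch, List.length_append, List.length_cons, List.length_nil]
    omega
  rw [← hfinal] at hend
  rw [Answers, iterate_step_of_halted hle hend, hfinal, hreg0, hreg1]
  exact ⟨hfinal ▸ hend, hanswer'⟩

end QueryProgram

/-! ### Windows and scales -/

section Windows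

variable {σ : Type*} {w : List σ} {n L d : ℕ}

theorem substr_infix (w : List σ) (i j : ℕ) : substr w i j <:+: w :=
  (List.take_prefix _ _).isInfix.trans (List.drop_suffix _ _).isInfix

theorem length_substr {i j : ℕ} (hij : i ≤ j) (hj : j < w.length) :
    (substr w i j).length = j - i + 1 := by
  simp only [substr, List.length_take, List.length_drop]
  omega

theorem substr_take_drop (w : List σ) {k ℓ i j : ℕ} (hj : j < ℓ) :
    substr ((w.drop k).take ℓ) i j = substr w (k + i) (k + j) := by
  rw [substr, substr, List.drop_take, List.take_take, List.drop_drop,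
    min_eq_left (by omega), show k + j + 1 - (k + i) = j + 1 - i by omega]

/-- The position in a string of length `n` at which the `k`-th window of length `L` starts, when
successive windows are shifted by `d`. The windows that would stick out at the end are moved back,
so that all have the same length `min L n`. -/
def windowStart (n L d k : ℕ) : ℕ := min (k * d) (n - L)

/-- The windows of length `L` in `w`, shifted by `d`. -/
def windows (w : List σ) (L d : ℕ) (k : Fin (w.length / d + 1)) : List σ :=
  (w.drop (windowStart w.length L d k)).take (min L w.length)

theorem windowStart_add_le (n L d k : ℕ) : windowStart n L d k + min L n ≤ n := by
  unfold windowStart; omega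

theorem windowStart_div_le (n L d i : ℕ) : windowStart n L d (i / d) ≤ i :=
  (min_le_left _ _).trans (Nat.div_mul_le_self i d)

theorem add_le_windowStart_div_add {i m : ℕ} (hd : 0 < d) (hi : i + m ≤ n) (hm : m + d ≤ L + 1) :
    i + m ≤ windowStart n L d (i / d) + min L n := by
  have hlt := Nat.lt_div_mul_add (a := i) hd
  unfold windowStart; omega

theorem length_windows (k : Fin (w.length / d + 1)) :
    (windows w L d k).length = min L w.length := by
  have hle := windowStart_add_le w.length L d k
  rw [windows, List.length_take, List.length_drop, min_eq_left (by omega)]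

theorem card_windows_mul_le {c : ℕ} (hc : L ≤ c * d) : (n / d + 1) * min L n ≤ (c + 1) * n :=
  calc (n / d + 1) * min L n = n / d * min L n + min L n := by rw [add_one_mul]
    _ ≤ n / d * (c * d) + n :=
      add_le_add (Nat.mul_le_mul_left _ ((min_le_left _ _).trans hc)) (min_le_right _ _)
    _ = c * (n / d * d) + n := by ring
    _ ≤ (c + 1) * n := by
      rw [add_one_mul]
      exact Nat.add_le_add_right (Nat.mul_le_mul_left c (Nat.div_mul_le_self n d)) n

theorem substr_windows {i j : ℕ} {k : Fin (w.length / d + 1)}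
    (hstart : windowStart w.length L d k ≤ i) (hij : i ≤ j)
    (hend : j < windowStart w.length L d k + min L w.length) :
    substr (windows w L d k) (i - windowStart w.length L d k)
      (i - windowStart w.length L d k + (j - i)) = substr w i j := by
  rw [windows, substr_take_drop w (by omega)]
  congr 1 <;> omega

theorem exists_infix_windows {r : List σ} (hd : 0 < d) (hr : r <:+: w)
    (hlen : r.length + d ≤ L + 1) : ∃ k, r <:+: windows w L d k := by
  rcases r.eq_nil_or_concat with rfl | ⟨r', a, hra⟩
  · exact ⟨0, List.nil_infix⟩
  obtain ⟨p, q, hw⟩ := hr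
  have hr : r.length = r'.length + 1 := by rw [hra, List.length_concat]
  have hi : p.length + r.length ≤ w.length := by simp [← hw]
  have hsubstr : substr w p.length (p.length + r'.length) = r := by
    rw [substr, ← hw, List.append_assoc, List.drop_left, add_assoc, Nat.add_sub_cancel_left, ← hr,
      List.take_left]
  have hend := add_le_windowStart_div_add hd hi hlen
  have hk : p.length / d < w.length / d + 1 :=
    Nat.lt_succ_of_le (Nat.div_le_div_right (by omega))
  refine ⟨⟨p.length / d, hk⟩, ?_⟩
  rw [← hsubstr, ← substr_windows (k := ⟨p.length / d, hk⟩) (windowStart_div_le _ L d _)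
    (Nat.le_add_right _ _) (by simp only; omega)]
  exact substr_infix _ _ _

theorem suffix_windows_last {r : List σ} (hd : 0 < d) (hdL : d ≤ L) (hr : r <:+ w)
    (hlen : r.length ≤ L) : r <:+ windows w L d (Fin.last _) := by
  have hlast : windows w L d (Fin.last _) = w.drop (w.length - L) := by
    have hlt := Nat.lt_div_mul_add (a := w.length) hd
    have hstart : windowStart w.length L d (w.length / d) = w.length - L :=
      min_eq_right (by omega)
    rw [windows, Fin.val_last, hstart, List.take_of_length_le (by rw [List.length_drop]; omega)]
  rw [hlast]
  refine List.suffix_of_suffix_length_le hr (List.drop_suffix _ _) ?_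
  have hle := hr.length_le
  rw [List.length_drop]
  omega

theorem covers_windows {m : ℕ} (hd : 0 < d) (hm : m + d ≤ L) : Covers (windows w L d) w m :=
  ⟨fun _ hr hlen => exists_infix_windows hd hr (by omega),
    fun _ hr hlen => ⟨_, suffix_windows_last hd (by omega) hr (by omega)⟩⟩

theorem PointsTo.windows_lt {c : ℕ} {ptr : List (σ ⊕ Fin (w.length / d + 1)) → ℕ} {s : List σ}
    {kind p : ℕ} (hw : 0 < w.length) (hL : 0 < L) (hc : L ≤ c * d)
    (hptr : IsPointerMap (windows w L d) ptr) (h : PointsTo (windows w L d) ptr s kind p) :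
    p < 6 * (c + 1) * w.length := by
  refine (h.lt hptr).trans_le ?_
  simp only [length_windows, Finset.sum_const, Finset.card_univ, Fintype.card_fin, smul_eq_mul]
  have hle : min L w.length + 2 ≤ 3 * min L w.length := by omega
  calc 2 * ((w.length / d + 1) * (min L w.length + 2))
      ≤ 2 * ((w.length / d + 1) * (3 * min L w.length)) := by gcongr
    _ = 6 * ((w.length / d + 1) * min L w.length) := by ring
    _ ≤ 6 * ((c + 1) * w.length) := Nat.mul_le_mul_left 6 (card_windows_mul_le hc)
    _ = 6 * (c + 1) * w.length := (mul_assoc _ _ _).symm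

end Windows

/-- The scale of a length: lengths are on the same scale if they have the same number of binary
digits and the same four leading digits. Scale `16 * b + q - 1` consists of the lengths `m` with
`m / 2 ^ b = q`, where `8 ≤ q < 16` unless `b = 0`. -/
def scaleOf (m : ℕ) : ℕ := 16 * (Nat.log 2 m - 3) + m / 2 ^ (Nat.log 2 m - 3) - 1

/-- The length of the windows in which the substrings with length on scale `t` are looked up. On
scale `16 * b + q - 1` this is `(q + 2) * 2 ^ b - 2`: for `b > 0` it exceeds every length of the
scale, all below `(q + 1) * 2 ^ b`, by the shift of the windows at least, and for `b = 0` it is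
their common value `q`. -/
def scaleLen (t : ℕ) : ℕ := (t % 16 + 3) * 2 ^ (t / 16) - 2

/-- The shift between the windows of scale `t`. -/
def scaleStep (t : ℕ) : ℕ := 2 ^ (t / 16 - 1)

theorem scaleStep_pos (t : ℕ) : 0 < scaleStep t := Nat.two_pow_pos _

theorem scaleLen_pos (t : ℕ) : 0 < scaleLen t := by
  have hle : (t % 16 + 3) * 1 ≤ (t % 16 + 3) * 2 ^ (t / 16) :=
    Nat.mul_le_mul_left _ (Nat.two_pow_pos _)
  unfold scaleLen
  omega

theorem scaleLen_le (t : ℕ) : scaleLen t ≤ 36 * scaleStep t := by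
  have hpow : 2 ^ (t / 16) ≤ 2 * 2 ^ (t / 16 - 1) := by
    rw [← pow_succ']
    exact Nat.pow_le_pow_right Nat.two_pos (by omega)
  calc scaleLen t ≤ (t % 16 + 3) * 2 ^ (t / 16) := Nat.sub_le _ _
    _ ≤ 18 * (2 * 2 ^ (t / 16 - 1)) := Nat.mul_le_mul (by omega) hpow
    _ = 36 * scaleStep t := by rw [scaleStep]; ring

theorem scaleOf_of_lt {m : ℕ} (hm : m < 16) : scaleOf m = m - 1 := by
  have hlog : Nat.log 2 m - 3 = 0 := by
    have := Nat.log_lt_of_lt_pow' (b := 2) (x := 4) (y := m) (by norm_num) (by omega)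
    omega
  simp [scaleOf, hlog]

theorem exists_scaleOf_eq {m : ℕ} (hm : 16 ≤ m) :
    ∃ b q, 0 < b ∧ b ≤ Nat.log 2 m ∧ 8 ≤ q ∧ q < 16 ∧
      scaleOf m = 16 * b + (q - 1) ∧ q * 2 ^ b ≤ m ∧ m < (q + 1) * 2 ^ b := by
  have hlog : 4 ≤ Nat.log 2 m := Nat.le_log_of_pow_le (by norm_num) hm
  obtain ⟨b, hb⟩ := Nat.exists_eq_add_of_le' (show 3 ≤ Nat.log 2 m by omega)
  have hlow : 8 * 2 ^ b ≤ m :=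
    calc 8 * 2 ^ b = 2 ^ Nat.log 2 m := by rw [hb, pow_add]; ring
      _ ≤ m := Nat.pow_log_le_self 2 (by omega)
  have hhigh : m < 16 * 2 ^ b :=
    calc m < 2 ^ (Nat.log 2 m + 1) := Nat.lt_pow_succ_log_self (by norm_num) m
      _ = 16 * 2 ^ b := by rw [hb]; ring
  have hq : 8 ≤ m / 2 ^ b := (Nat.le_div_iff_mul_le (by positivity)).2 hlow
  refine ⟨b, m / 2 ^ b, by omega, by omega, hq, Nat.div_lt_of_lt_mul (by rwa [mul_comm]), ?_,
    Nat.div_mul_le_self m _, ?_⟩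
  · rw [scaleOf, hb, Nat.add_sub_cancel]
    omega
  · rw [add_one_mul]
    exact Nat.lt_div_mul_add (by positivity)

theorem scaleOf_lt {m n : ℕ} (hmn : m ≤ n) : scaleOf m < 16 * (Nat.log 2 n + 1) := by
  rcases lt_or_ge m 16 with h | h
  · rw [scaleOf_of_lt h]
    omega
  · obtain ⟨b, q, -, hb, -, hq, ht, -⟩ := exists_scaleOf_eq h
    have hlog := Nat.log_mono_right (b := 2) hmn
    omega

theorem exists_scaleLen_eq {m : ℕ} (hm : 16 ≤ m) :
    ∃ a q, 8 ≤ q ∧ scaleStep (scaleOf m) = a ∧ 0 < a ∧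
      scaleLen (scaleOf m) = (q + 2) * (2 * a) - 2 ∧ q * (2 * a) ≤ m ∧ m < (q + 1) * (2 * a) := by
  obtain ⟨b, q, hb, -, hq8, hq16, ht, hlow, hhigh⟩ := exists_scaleOf_eq hm
  obtain ⟨b, rfl⟩ := Nat.exists_eq_add_of_le' hb
  have hdiv : (16 * (b + 1) + (q - 1)) / 16 = b + 1 := by omega
  have hmod : (16 * (b + 1) + (q - 1)) % 16 + 3 = q + 2 := by omega
  rw [pow_succ'] at hlow hhigh
  refine ⟨2 ^ b, q, hq8, ?_, by positivity, ?_, hlow, hhigh⟩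
  · rw [scaleStep, ht, hdiv, Nat.add_sub_cancel]
  · rw [scaleLen, ht, hdiv, hmod, pow_succ']

theorem add_scaleStep_le_scaleLen {m : ℕ} (hm : 16 ≤ m) :
    m + scaleStep (scaleOf m) ≤ scaleLen (scaleOf m) := by
  obtain ⟨a, q, -, hstep, ha, hlen, -, hhigh⟩ := exists_scaleLen_eq hm
  rw [hstep, hlen]
  simp only [add_mul] at *
  omega

theorem scaleLen_of_lt {m : ℕ} (hm : 0 < m) (h : m < 16) :
    scaleLen (scaleOf m) = m ∧ scaleStep (scaleOf m) = 1 := by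
  have hdiv : (m - 1) / 16 = 0 := by omega
  rw [scaleLen, scaleStep, scaleOf_of_lt h, hdiv]
  constructor <;> omega

theorem add_scaleStep_le_scaleLen_add_one {m : ℕ} (hm : 0 < m) :
    m + scaleStep (scaleOf m) ≤ scaleLen (scaleOf m) + 1 := by
  rcases lt_or_ge m 16 with h | h
  · rw [(scaleLen_of_lt hm h).1, (scaleLen_of_lt hm h).2]
  · exact (add_scaleStep_le_scaleLen h).trans (Nat.le_succ _)

theorem three_mul_scaleLen_le {m : ℕ} (hm : 0 < m) : 3 * scaleLen (scaleOf m) ≤ 4 * m := by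
  rcases lt_or_ge m 16 with h | h
  · rw [(scaleLen_of_lt hm h).1]
    omega
  · obtain ⟨a, q, hq, -, -, hlen, hlow, -⟩ := exists_scaleLen_eq h
    rw [hlen]
    calc 3 * ((q + 2) * (2 * a) - 2) ≤ 3 * ((q + 2) * (2 * a)) := by omega
      _ = (3 * q + 6) * (2 * a) := by ring
      _ ≤ 4 * q * (2 * a) := Nat.mul_le_mul_right _ (by omega)
      _ ≤ 4 * m := by rw [mul_assoc]; exact Nat.mul_le_mul_left 4 hlow

theorem sixteen_le_of_scaleOf_eq {m₁ m₂ : ℕ} (hm₁ : 0 < m₁) (hlt : m₁ < m₂)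
    (h : scaleOf m₁ = scaleOf m₂) : 16 ≤ m₂ := by
  by_contra! h16
  rw [scaleOf_of_lt h16, scaleOf_of_lt (hlt.trans h16)] at h
  omega

/-! ### The memory -/

section Memory

variable {σ : Type*} {W W' T Y t : ℕ} {P : List Instr} {w : List σ}
  {ptr : List (σ ⊕ Fin 1) → ℕ}

/-- With words of `W` bits, program `P` solves every instance of long substring retrieval with
string `w` and constant `c`, in time `T` and with at most `Y` words of memory. -/
def SolvesLong (c W T Y : ℕ) (P : List Instr) (w : List σ) : Prop :=
  ∀ (ℓ β : ℕ) (start : Fin β → ℕ) (ptr : List (σ ⊕ Fin β) → ℕ),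
    0 < ℓ → β * ℓ ≤ c * w.length → (∀ k, start k + ℓ ≤ w.length) →
    let docs : Fin β → List σ := fun k => (w.drop (start k)).take ℓ
    IsPointerMap docs ptr →
    ∃ D : List ℕ, D.length ≤ Y ∧ (∀ x ∈ D, x < 2 ^ W) ∧
      ∀ (k : Fin β) (i j : ℕ), i ≤ j → j < ℓ → 3 * ℓ ≤ 4 * (j + 1 - i) →
        Answers W P T D [k, i, j] (PointsTo docs ptr (substr (docs k) i j))

/-- What is stored in order to answer queries for substrings of `w` with length on scale `t`: the
memory of the program `P` for the windows of this scale, and the answer in the suffix tree of `w`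
that an answer `(kind, p)` of `P` stands for, as a function of `2 * p + kind`. The windows' tree has
at most `6 * 37 * w.length` explicit nodes, hence `2 * p + kind < 444 * w.length`. -/
structure ScaleTables (W T Y : ℕ) (P : List Instr) (w : List σ) (ptr : List (σ ⊕ Fin 1) → ℕ)
    (t : ℕ) where
  data : List ℕ
  kind : ℕ → ℕ
  pointer : ℕ → ℕ
  length_data_le : data.length ≤ Y
  data_lt : ∀ x ∈ data, x < 2 ^ W
  kind_le : ∀ q, kind q ≤ 1
  pointer_lt : ∀ q, pointer q < 2 * (w.length + 2)
  answers : ∀ i j, i ≤ j → j < w.length → scaleOf (j - i + 1) = t →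
    let o := i - windowStart w.length (scaleLen t) (scaleStep t) (i / scaleStep t)
    ∃ good, Answers W P T data [i / scaleStep t, o, o + (j - i)] good ∧
      ∀ kind' p, good kind' p → 2 * p + kind' < 444 * w.length ∧
        PointsTo (fun _ => w) ptr (substr w i j) (kind (2 * p + kind')) (pointer (2 * p + kind'))

theorem exists_answer_translation {wptr : List (σ ⊕ Fin (w.length / scaleStep t + 1)) → ℕ}
    (hwptr : IsPointerMap (windows w (scaleLen t) (scaleStep t)) wptr)
    (hptr : IsPointerMap (fun _ : Fin 1 => w) ptr) :
    ∃ kind pointer : ℕ → ℕ, (∀ q, kind q ≤ 1) ∧ (∀ q, pointer q < 2 * (w.length + 2)) ∧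
      ∀ s, s <:+: w → s ≠ [] → scaleOf s.length = t → ∀ kind' p,
        PointsTo (windows w (scaleLen t) (scaleStep t)) wptr s kind' p →
        PointsTo (fun _ => w) ptr s (kind (2 * p + kind')) (pointer (2 * p + kind')) := by
  set X : Set (List σ) := {s | s <:+: w ∧ s ≠ [] ∧ scaleOf s.length = t}
  have hcov : ∀ s₁ ∈ X, ∀ s₂ ∈ X, s₁.length < s₂.length →
      Covers (windows w (scaleLen t) (scaleStep t)) w s₂.length := by
    rintro s₁ ⟨-, hne, h₁⟩ s₂ ⟨-, -, h₂⟩ hlt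
    have h16 := sixteen_le_of_scaleOf_eq (List.length_pos_iff.2 hne) hlt (h₁.trans h₂.symm)
    exact covers_windows (scaleStep_pos t) (by simpa only [h₂] using add_scaleStep_le_scaleLen h16)
  have htable : ∀ q, ∃ kind p, kind ≤ 1 ∧ p < 2 * (w.length + 2) ∧ ∀ s ∈ X,
      PointsTo (windows w (scaleLen t) (scaleStep t)) wptr s (q % 2) (q / 2) →
      PointsTo (fun _ => w) ptr s kind p := by
    intro q
    by_cases hne : ∃ s ∈ X, PointsTo (windows w (scaleLen t) (scaleStep t)) wptr s (q % 2) (q / 2)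
    · obtain ⟨kind, p, ⟨s, hs⟩, himp⟩ :=
        exists_pointsTo_of_pointsTo ptr X hwptr.injOn (fun s hs => hs.1) hcov hne
      exact ⟨kind, p, hs.kind_le_one, by simpa using hs.lt hptr, himp⟩
    · exact ⟨0, 0, zero_le_one, by omega, fun s hs h => absurd ⟨s, hs, h⟩ hne⟩
  choose kind pointer hkind hpointer himp using htable
  refine ⟨kind, pointer, hkind, hpointer, fun s hs hne hst kind' p h => himp _ s ⟨hs, hne, hst⟩ ?_⟩
  have hle := h.kind_le_one
  rwa [show (2 * p + kind') % 2 = kind' by omega, show (2 * p + kind') / 2 = p by omega]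

theorem nonempty_scaleTables (hw : 0 < w.length) (hP : SolvesLong 37 W T Y P w)
    (hptr : IsPointerMap (fun _ : Fin 1 => w) ptr) (t : ℕ) :
    Nonempty (ScaleTables W T Y P w ptr t) := by
  obtain ⟨wptr, hwptr⟩ := exists_isPointerMap (windows w (scaleLen t) (scaleStep t))
  obtain ⟨D, hlen, hlt, hD⟩ := hP (min (scaleLen t) w.length) _ _ wptr
    (lt_min (scaleLen_pos t) hw) (card_windows_mul_le (scaleLen_le t))
    (fun k => windowStart_add_le w.length (scaleLen t) (scaleStep t) k) hwptr
  obtain ⟨kind, pointer, hkind, hpointer, htranslate⟩ := exists_answer_translation hwptr hptr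
  refine ⟨⟨D, kind, pointer, hlen, hlt, hkind, hpointer, fun i j hij hj ht => ?_⟩⟩
  have hm := add_scaleStep_le_scaleLen_add_one (m := j - i + 1) (by omega)
  have hlong := three_mul_scaleLen_le (m := j - i + 1) (by omega)
  rw [ht] at hm hlong
  have hstart := windowStart_div_le w.length (scaleLen t) (scaleStep t) i
  have hend := add_le_windowStart_div_add (n := w.length) (i := i) (scaleStep_pos t) (by omega) hm
  have hanswers := hD ⟨i / scaleStep t, Nat.lt_succ_of_le (Nat.div_le_div_right (by omega))⟩
    (i - windowStart w.length (scaleLen t) (scaleStep t) (i / scaleStep t))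
    (i - windowStart w.length (scaleLen t) (scaleStep t) (i / scaleStep t) + (j - i)) (by omega)
    (by omega) (by omega)
  refine ⟨_, hanswers, fun kind' p hgood => ?_⟩
  change PointsTo (windows w _ _) _ (substr (windows w _ _ _) _ _) _ _ at hgood
  rw [substr_windows hstart hij (by simp only; omega)] at hgood
  have hp := hgood.windows_lt hw (scaleLen_pos t) (scaleLen_le t) hwptr
  have hkind' := hgood.kind_le_one
  have hsubstr := length_substr hij hj
  exact ⟨by omega, htranslate _ (substr_infix w i j)
    (List.ne_nil_of_length_pos (by omega)) (by rwa [hsubstr]) _ _ hgood⟩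

/-- The five tracks of a scale. -/
def ScaleTables.track (tab : ScaleTables W T Y P w ptr t) : ℕ → List ℕ
  | 0 => (List.range w.length).map (· / scaleStep t)
  | 1 => (List.range w.length).map fun i =>
    i - windowStart w.length (scaleLen t) (scaleStep t) (i / scaleStep t)
  | 2 => tab.data
  | 3 => (List.range (444 * w.length)).map tab.kind
  | _ => (List.range (444 * w.length)).map tab.pointer

/-- The number of tracks in the memory for a string of length `n`. -/
def trackCount (n : ℕ) : ℕ := 3 + 80 * (Nat.log 2 n + 1)

/-- The tracks of the memory. The first two hold the constants used by the query program, the third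
one the number of the first track of the scale of each length; then come the tracks of the
scales. -/
def tracks (tables : ∀ t, ScaleTables W T Y P w ptr t) : ℕ → List ℕ
  | 0 => [trackCount w.length]
  | 1 => [2 ^ W]
  | 2 => (List.range w.length).map fun a => 3 + 5 * scaleOf (a + 1)
  | c + 3 => (tables (c / 5)).track (c % 5)

theorem tracks_scale (tables : ∀ t, ScaleTables W T Y P w ptr t) (t : ℕ) {c : ℕ} (hc : c < 5) :
    tracks tables (3 + 5 * t + c) = (tables t).track c := by
  rw [show 3 + 5 * t + c = 5 * t + c + 3 by omega, tracks, show (5 * t + c) / 5 = t by omega,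
    show (5 * t + c) % 5 = c by omega]

theorem ScaleTables.length_track_le (tab : ScaleTables W T Y P w ptr t) (c : ℕ) :
    (tab.track c).length ≤ 444 * w.length + Y := by
  have hY := tab.length_data_le
  unfold track
  split
  case h_3 => omega
  all_goals simp only [List.length_map, List.length_range]; omega

theorem length_tracks_le (hw : 0 < w.length) (tables : ∀ t, ScaleTables W T Y P w ptr t) (c : ℕ) :
    (tracks tables c).length ≤ 444 * w.length + Y := by
  unfold tracks
  split
  case h_4 => exact (tables _).length_track_le _
  all_goals simp only [List.length_map, List.length_range, List.length_singleton]; omega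

theorem ScaleTables.track_lt (tab : ScaleTables W T Y P w ptr t) (hw : 0 < w.length)
    (hW : 444 * w.length ≤ 2 ^ W) (c : ℕ) : ∀ x ∈ tab.track c, x < 2 ^ W := by
  unfold track
  split
  case h_3 => exact tab.data_lt
  all_goals
    simp only [List.forall_mem_map, List.mem_range]
    intro a ha
  · exact (Nat.div_le_self _ _).trans_lt (by omega)
  · omega
  · exact (tab.kind_le a).trans_lt (by omega)
  · exact (tab.pointer_lt a).trans_le (by omega)

theorem tracks_lt (hw : 0 < w.length) (tables : ∀ t, ScaleTables W' T Y P w ptr t)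
    (hW' : 444 * w.length ≤ 2 ^ W') (hW : trackCount w.length * 2 ^ W' ≤ 2 ^ W) (c : ℕ) :
    ∀ x ∈ tracks tables c, x < 2 ^ W := by
  have hcount : trackCount w.length < 2 ^ W :=
    (lt_mul_of_one_lt_right (by unfold trackCount; omega) (by omega)).trans_le hW
  have hpow : 2 ^ W' < 2 ^ W :=
    (lt_mul_of_one_lt_left (by omega) (by unfold trackCount; omega)).trans_le hW
  unfold tracks
  split
  case h_4 => exact fun x hx => ((tables _).track_lt hw hW' _ x hx).trans hpow
  · simpa only [List.forall_mem_singleton] using hcount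
  · simpa only [List.forall_mem_singleton] using hpow
  · simp only [List.forall_mem_map, List.mem_range]
    intro a ha
    have hscale := scaleOf_lt (m := a + 1) (n := w.length) (by omega)
    unfold trackCount at hcount
    omega

/-- The memory in which cell `a` of track `c` is cell `a * G + c`, for `c < G` and `a < L`. -/
def interleave (G L : ℕ) (track : ℕ → List ℕ) : List ℕ :=
  (List.range (G * L)).map fun x => (track (x % G)).getD (x / G) 0

theorem getD_map_range {f : ℕ → ℕ} {L a : ℕ} (ha : a < L) :
    ((List.range L).map f).getD a 0 = f a := by
  rw [List.getD_eq_getElem _ _ (by simpa using ha), List.getElem_map, List.getElem_range]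

theorem isInterleaved_interleave {G L : ℕ} {track : ℕ → List ℕ} (hG : G * 2 ^ W' ≤ 2 ^ W)
    (hlen : ∀ c, (track c).length ≤ L) : IsInterleaved W W' G (interleave G L track) track where
  mul_le := hG
  getD_eq c hc a := by
    rcases lt_or_ge a L with ha | ha
    · have hlt : a * G + c < G * L :=
        calc a * G + c < (a + 1) * G := by rw [add_one_mul]; omega
          _ ≤ L * G := Nat.mul_le_mul_right G ha
          _ = G * L := mul_comm _ _
      rw [interleave, getD_map_range hlt, mul_comm a G, Nat.mul_add_mod, Nat.mod_eq_of_lt hc,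
        Nat.mul_add_div (by omega), Nat.div_eq_of_lt hc, add_zero]
    · have hge : G * L ≤ a * G + c := by
        rw [mul_comm]
        exact (Nat.mul_le_mul_right G ha).trans (Nat.le_add_right _ _)
      rw [List.getD_eq_default _ _ (by simpa [interleave] using hge),
        List.getD_eq_default _ _ ((hlen c).trans ha)]

theorem exists_memory (hw : 0 < w.length) (tables : ∀ t, ScaleTables W' T Y P w ptr t)
    (hW' : 444 * w.length ≤ 2 ^ W') (hW : trackCount w.length * 2 ^ W' ≤ 2 ^ W) :
    ∃ D : List ℕ, D.length ≤ trackCount w.length * (444 * w.length + Y) ∧ (∀ x ∈ D, x < 2 ^ W) ∧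
      ∀ i j, i ≤ j → j < w.length → Answers W (queryProgram P) (28 + 3 * T) D [i, j]
        (PointsTo (fun _ => w) ptr (substr w i j)) := by
  set G := trackCount w.length with hG
  set D := interleave G (444 * w.length + Y) (tracks tables) with hDdef
  have hD : IsInterleaved W W' G D (tracks tables) :=
    isInterleaved_interleave hW (length_tracks_le hw tables)
  refine ⟨D, by simp [hDdef, interleave], ?_, fun i j hij hj => ?_⟩
  · simp only [hDdef, interleave, List.forall_mem_map]
    exact fun x _ => getD_zero_lt (by positivity) (tracks_lt hw tables hW' hW _) _
  set t := scaleOf (j - i + 1)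
  obtain ⟨good, hP, hgood⟩ := (tables t).answers i j hij hj rfl
  have htracks : 3 + 5 * t + 4 < G := by
    have hscale := scaleOf_lt (m := j - i + 1) (n := w.length) (by omega)
    rw [hG, trackCount]
    omega
  refine answers_queryProgram hD (b := 3 + 5 * t) rfl rfl htracks (getD_map_range (by omega))
    ((congrArg (·.getD i 0) (tracks_scale tables t (c := 0) (by omega))).trans
      (getD_map_range (by omega)))
    ((congrArg (·.getD i 0) (tracks_scale tables t (c := 1) (by omega))).trans
      (getD_map_range (by omega)))
    (by rw [tracks_scale tables t (by omega)]; exact (tables t).data_lt) hij (by omega)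
    ((Nat.div_le_self _ _).trans_lt (by omega)) (by omega)
    (by rw [tracks_scale tables t (by omega)]; exact hP) fun kind p h => ?_
  obtain ⟨hlt, hpoints⟩ := hgood kind p h
  rw [tracks_scale tables t (by omega), tracks_scale tables t (by omega)]
  refine ⟨hlt.trans_le hW', ?_⟩
  change PointsTo _ _ _ (((List.range _).map (tables t).kind).getD _ 0)
    (((List.range _).map (tables t).pointer).getD _ 0)
  rwa [getD_map_range hlt, getD_map_range hlt]

end Memory

/-! ### Word size and space -/

theorem mul_two_pow_wordSize_le {a x κ n : ℕ} (κ' : ℕ) (ha : a ≤ 2 ^ κ)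
    (hx : x ≤ 2 ^ (Nat.log 2 n + 1)) :
    a * x * 2 ^ wordSize κ' n ≤ 2 ^ wordSize (κ + 1 + κ') n :=
  calc a * x * 2 ^ wordSize κ' n
      ≤ 2 ^ (κ * (Nat.log 2 n + 1)) * 2 ^ (Nat.log 2 n + 1) * 2 ^ wordSize κ' n := by
        gcongr
        exact ha.trans (Nat.pow_le_pow_right Nat.two_pos (Nat.le_mul_of_pos_right _ (by omega)))
    _ = 2 ^ wordSize (κ + 1 + κ') n := by
        rw [wordSize, wordSize, ← pow_add, ← pow_add]
        ring

theorem mul_le_two_pow_wordSize (n : ℕ) {κ : ℕ} (hκ : 10 ≤ κ) : 444 * n ≤ 2 ^ wordSize κ n :=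
  calc 444 * n = 444 * n * 2 ^ wordSize 0 n := by simp [wordSize]
    _ ≤ 2 ^ wordSize (9 + 1 + 0) n :=
      mul_two_pow_wordSize_le 0 (by norm_num) (Nat.lt_pow_succ_log_self one_lt_two n).le
    _ ≤ 2 ^ wordSize κ n := Nat.pow_le_pow_right Nat.two_pos (Nat.mul_le_mul_right _ hκ)

theorem trackCount_le (n : ℕ) : trackCount n ≤ 83 * (Nat.log 2 n + 1) := by
  unfold trackCount; omega

theorem trackCount_mul_le (n κ : ℕ) :
    trackCount n * 2 ^ wordSize κ n ≤ 2 ^ wordSize (κ + 8) n :=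
  calc trackCount n * 2 ^ wordSize κ n ≤ 83 * (Nat.log 2 n + 1) * 2 ^ wordSize κ n :=
      Nat.mul_le_mul_right _ (trackCount_le n)
    _ ≤ 2 ^ wordSize (7 + 1 + κ) n :=
      mul_two_pow_wordSize_le κ (by norm_num) Nat.lt_two_pow_self.le
    _ = 2 ^ wordSize (κ + 8) n := by rw [add_comm]

theorem trackCount_mul_add_le (n A y : ℕ) :
    trackCount n * (444 * n + A * y) ≤ 83 * (444 + A) * ((y + n) * (Nat.log 2 n + 1)) :=
  calc trackCount n * (444 * n + A * y)
      ≤ 83 * (Nat.log 2 n + 1) * ((444 + A) * (y + n)) :=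
        Nat.mul_le_mul (trackCount_le n) (by nlinarith)
    _ = 83 * (444 + A) * ((y + n) * (Nat.log 2 n + 1)) := by ring

end SubstringRetrieval

open SubstringRetrieval

theorem mainTheorem8 {σ : Type*} (S : ℕ → ℕ)
    (hS : SubstringRetrieval.LongSolvable σ S) :
    SubstringRetrieval.GeneralSolvable σ (fun n => (S n + n) * (Nat.log 2 n + 1)) := by
  obtain ⟨κ₀, hκ₀⟩ := hS 37
  refine ⟨κ₀ + 18, fun κ hκ => ?_⟩
  obtain ⟨κ, rfl⟩ := Nat.exists_eq_add_of_le' (show 8 ≤ κ by omega)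
  obtain ⟨P, T, A, hlong⟩ := hκ₀ κ (by omega)
  refine ⟨queryProgram P, 28 + 3 * T, 83 * (444 + A), fun w ptr hptr => ?_⟩
  rcases w.length.eq_zero_or_pos with hw | hw
  · exact ⟨[], Nat.zero_le _, by simp, fun i j _ hj => absurd hj (by omega)⟩
  have hP : SolvesLong 37 (wordSize κ w.length) T (A * S w.length) P w := hlong w
  obtain ⟨D, hlen, hlt, hanswers⟩ := exists_memory hw
    (fun t => (nonempty_scaleTables hw hP hptr t).some)
    (mul_le_two_pow_wordSize w.length (by omega)) (trackCount_mul_le w.length κ)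
  exact ⟨D, hlen.trans (trackCount_mul_add_le _ A _), hlt, hanswers⟩
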